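/- **Definitions.** An *input/output stochastic automaton with urgency* (IOSA) consists of a countable set $\mathcal S$ of states; a countable set $\mathcal A$ of labels partitioned into inputs $\mathcal A^{\mathsf i}$ and outputs $\mathcal A^{\mathsf o}$, with a subset $\mathcal A^{\mathsf u}\subseteq\mathcal A$ of urgent labels and a silent label $\tau\in\mathcal A^{\mathsf u}\cap\mathcal A^{\mathsf o}$; a finite set $\mathcal C$ of clocks, each $x\in\mathcal C$ with an atomless probability measure $\mu_x$ on $\mathbb R$ such that $\mu_x(\mathbb R_{>0})=1$; a set of transitions $s\xrightarrow{C,a,C'}s'$ with $s,s'\in\mathcal S$, $a\in\mathcal A$, $C,C'\subseteq\mathcal C$; a set $C_0\subseteq\mathcal C$; and an initial state $s_0$. Call $s$ *stable* if no $s\xrightarrow{\emptyset,a,C'}s'$ with $a\in\mathcal A^{\mathsf u}\cap\mathcal A^{\mathsf o}$ exists, and let $\mathrm{enabling}(s)=\{y\mid \exists a,C',s':\ s\xrightarrow{\{y\},a,C'}s'\}$. It is required that - (a) if $s\xrightarrow{C,a,C'}s'$ and $a\in\mathcal A^{\mathsf i}\cup\mathcal A^{\mathsf u}$, then $C=\emptyset$;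 - (b) if $s\xrightarrow{C,a,C'}s'$ and $a\in\mathcal A^{\mathsf o}\setminus\mathcal A^{\mathsf u}$, then $C$ is a singleton; - (c) if $s\xrightarrow{\{x\},a_1,C_1}s_1$ and $s\xrightarrow{\{x\},a_2,C_2}s_2$, then $a_1=a_2$, $C_1=C_2$, $s_1=s_2$; - (d) for all $a\in\mathcal A^{\mathsf i}$ and $s$ there is a transition $s\xrightarrow{\emptyset,a,C'}s'$; - (e) if $a\in\mathcal A^{\mathsf i}$, $s\xrightarrow{\emptyset,a,C_1}s_1$ and $s\xrightarrow{\emptyset,a,C_2}s_2$, then $C_1=C_2$ and $s_1=s_2$; - (f) there is $\mathrm{active}:\mathcal S\to 2^{\mathcal C}$ with $\mathrm{active}(s_0)\subseteq C_0$; $\mathrm{enabling}(s)\subseteq\mathrm{active}(s)$ for all $s$, with equality if $s$ is stable; and $\mathrm{active}(s)\subseteq(\mathrm{active}(t)\setminus C)\cup C'$ whenever $t\xrightarrow{C,a,C'}s$. The IOSA is *closed* if $\mathcal A^{\mathsf i}=\emptyset$. It is *confluent* if for all $a,b\in\mathcal A^{\mathsf u}$ and all transitions $s\xrightarrow{\emptyset,a,C_1}s_1$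 and $s\xrightarrow{\emptyset,b,C_2}s_2$ that are not one and the same transition, there is a state $s_3$ with $s_1\xrightarrow{\emptyset,b,C_2}s_3$ and $s_2\xrightarrow{\emptyset,a,C_1}s_3$. *Semantics.* The state space is $\mathbf S=(\mathcal S\cup\{\mathsf{init}\})\times\mathbb R^{\mathcal C}$ with its Borel $\sigma$-algebra ($\mathcal S\cup\{\mathsf{init}\}$ discrete), and the labels are $\mathcal A\cup\mathbb R_{>0}\cup\{\mathsf{init}\}$. For $v\in\mathbb R^{\mathcal C}$ let $\mu^{v}_{C,s}=\delta_s\times\prod_{x}\overline\mu_x$, with $\overline\mu_x=\mu_x$ for $x\in C$ and $\overline\mu_x=\delta_{v(x)}$ otherwise. Put $\mathcal T_{\mathsf{init}}(\mathsf{init},v)=\{\delta_{s_0}\times\prod_x\mu_x\}$. For $a\in\mathcal A$ and $s\in\mathcal S$ put $\mathcal T_a(s,v)=\{\mu^v_{C',s'}\mid s\xrightarrow{C,a,C'}s',\ v(x)\le 0\text{ for all }x\in C\}$. For $d>0$ and $s\in\mathcal S\cup\{\mathsf{init}\}$ put $\mathcal T_d(s,v)=\{\delta_s\times\prod_x\delta_{v(x)-d}\}$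 if no transition with a label in $\mathcal A^{\mathsf o}\cap\mathcal A^{\mathsf u}$ leaves $s$ and $d\le v(x)$ for every clock $x$ such that $s\xrightarrow{\{x\},a,C'}s'$ for some $a\in\mathcal A^{\mathsf o}$, $C'$, $s'$ (no transition leaves $\mathsf{init}$, which counts as stable). All other sets $\mathcal T_\ell(s,v)$ are empty. *Weak transitions.* Write $s\xrightarrow{C}_{\mathsf u}s'$ if $s\xrightarrow{\emptyset,a,C}s'$ for some $a\in\mathcal A^{\mathsf u}$. The relations $(s,v)\Rightarrow^{C}_n\mu$ ($n\ge1$) are given inductively by two rules. (T1) If $s\xrightarrow{C}_{\mathsf u}s'$ and $s'$ is stable, then $(s,v)\Rightarrow^C_1\mu^v_{C,s'}$. (T2) If $s\xrightarrow{C'}_{\mathsf u}s'$ and $C''$ is such that for every $v'\in\mathbb R^{\mathcal C}$ there is $\mu'$ with $(s',v')\Rightarrow^{C''}_n\mu'$, then $(s,v)\Rightarrow^{C'\cup C''}_{n+1}\int f^{C''}_n\,d\mu^v_{C',s'}$. Here $f^{C}_n(p)=\nu$ if $p\Rightarrow^{C}_n\nu$, and $f^{C}_n(p)$ is the zero measure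 if there is no such $\nu$. They are *well defined* if each $f^{C}_n$ is single-valued and measurable. Write $p\Rightarrow\mu$ if $p\Rightarrow^C_n\mu$ for some $n\ge1$ and $C$. *Almost never.* A scheduler assigns, measurably, to each finite path (alternating states and labels) a probability distribution over the pairs $(\ell,\mu)$, concentrated on those with $\mu\in\mathcal T_\ell(p)$, where $p$ is the last state of the path. With a starting state it induces a probability measure on infinite paths. A measurable $B\subseteq\mathbf S$ is *almost never reached* from $p_0$ if, under every scheduler, the set of paths from $p_0$ that visit $B$ has measure $0$. A closed IOSA is *weakly deterministic* if its weak transitions are well defined and every measurable $B\subseteq\mathbf S$, each of whose elements $(s,v)$ satisfies one of (i)–(iii) below, is almost never reached from any $(\mathsf{init},v_0)$: - (i) $s$ is stable and $\bigcup_{a\in\mathcal A\cup\{\mathsf{init}\}}\mathcal T_a(s,v)$ contains at least two different measures; - (ii) $s$ is not stable, and $(s,v)\Rightarrow\mu$ and $(s,v)\Rightarrow\mu'$ for some $\mu\ne\mu'$; - (iii) $s$ is not stable and $\mathcal T_a(s,v)\neq\emptyset$ for some $a\in\mathcal A^{\mathsf o}\setminus\mathcal A^{\mathsf u}$. **Theorem.**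 Every closed, confluent IOSA is weakly deterministic. -/

import Mathlib

open MeasureTheory ProbabilityTheory

noncomputable section

/-! ### Paths and schedulers of nondeterministic labelled Markov processes

A process with labels `L` and state space `X` is given by its transition function
`T : L → X → Set (ProbabilityMeasure X)`. -/

section Paths

variable {L X : Type*} [MeasurableSpace L] [MeasurableSpace X]

/-- One entry of a path `x₀ ℓ₁ x₁ ℓ₂ x₂ …`: the starting state `x₀`, or a pair `(ℓₙ, xₙ)`. -/
abbrev PathEntry (L X : Type*) := X ⊕ (L × X)

/-- The state in an entry of a path. -/
def PathEntry.state : PathEntry L X → X := Sum.elim id Prod.snd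

/-- Finite paths with `n` transitions. -/
abbrev History (L X : Type*) (n : ℕ) := (_ : Finset.Iic n) → PathEntry L X

/-- The last state of a finite path. -/
def History.last {n : ℕ} (h : History L X n) : X :=
  PathEntry.state (h ⟨n, Finset.mem_Iic.2 le_rfl⟩)

/-- A (randomized, history-dependent, measurable) scheduler: after each finite path it selects a
probability distribution over the labelled transitions that leave the last state of the path. -/
structure Scheduler (T : L → X → Set (ProbabilityMeasure X)) where
  choice : (n : ℕ) → Kernel (History L X n) (L × ProbabilityMeasure X)
  markov : ∀ n, IsMarkovKernel (choice n)
  admissible : ∀ n (h : History L X n), ∀ᵐ p ∂(choice n h), p.2 ∈ T p.1 h.last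

/-- Sampling a state from a given probability measure. -/
def sampleKernel (X : Type*) [MeasurableSpace X] : Kernel (ProbabilityMeasure X) X where
  toFun μ := (μ : Measure X)
  measurable' := measurable_subtype_coe

instance : IsMarkovKernel (sampleKernel X) := ⟨fun μ => μ.2⟩

/-- Executing a selected transition `(ℓ, μ)`: the label `ℓ` is kept, and the next state is
sampled from `μ`. -/
def execKernel (L X : Type*) [MeasurableSpace L] [MeasurableSpace X] :
    Kernel (L × ProbabilityMeasure X) (L × X) :=
  Kernel.deterministic Prod.fst measurable_fst ×ₖ (sampleKernel X).comap Prod.snd measurable_snd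

instance : IsMarkovKernel (execKernel L X) := by
  unfold execKernel; infer_instance

namespace Scheduler

variable {T : L → X → Set (ProbabilityMeasure X)}

/-- The distribution of the next entry of the path, given the path so far. -/
def step (η : Scheduler T) (n : ℕ) : Kernel (History L X n) (PathEntry L X) :=
  (execKernel L X ∘ₖ η.choice n).map Sum.inr

instance (η : Scheduler T) (n : ℕ) : IsMarkovKernel (η.step n) := by
  have := η.markov n
  exact Kernel.IsMarkovKernel.map _ measurable_inr

/-- The probability measure on infinite paths starting in `x₀` under the scheduler `η`. -/
def pathMeasure (η : Scheduler T) (x₀ : X) : Measure (ℕ → PathEntry L X) :=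
  Kernel.traj (X := fun _ => PathEntry L X) η.step 0 (fun _ => Sum.inl x₀)

end Scheduler

/-- The set `B` is almost never reached from `x₀`: under every scheduler, the set of the paths
from `x₀` that visit `B` has measure zero. -/
def AlmostNeverReached (T : L → X → Set (ProbabilityMeasure X)) (x₀ : X) (B : Set X) : Prop :=
  ∀ η : Scheduler T, η.pathMeasure x₀ {ω | ∃ n, PathEntry.state (ω n) ∈ B} = 0

end Paths

/-! ### Input/output stochastic automata with urgency -/

/-- The clocks that enable some transition in state `s`. -/
def enablingClocks {S A C : Type*} (trans : S → Set C → A → Set C → S → Prop) (s : S) : Set C :=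
  {y | ∃ a K' s', trans s {y} a K' s'}

/-- A state is stable if no transition labelled in `UO` (the urgent outputs) leaves it. -/
def IsStableState {S A C : Type*} (trans : S → Set C → A → Set C → S → Prop) (UO : Set A)
    (s : S) : Prop :=
  ¬ ∃ a ∈ UO, ∃ K' s', trans s ∅ a K' s'

/-- Input/output stochastic automata with urgency, with states `S`, labels `A` and clocks `C`.
`trans s K a K' s'` is the transition from `s` to `s'` with label `a` that is controlled by the
clocks in `K` and resets the clocks in `K'`. The output labels are the labels that are not
inputs. -/
structure IOSA (S A C : Type*) where
  input : Set A
  urgent : Set A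
  /-- the silent action -/
  tau : A
  tau_mem : tau ∈ urgent ∩ inputᶜ
  /-- the distribution of each clock -/
  clock : C → ProbabilityMeasure ℝ
  clock_continuous : ∀ x (r : ℝ), (clock x : Measure ℝ) {r} = 0
  clock_pos : ∀ x, (clock x : Measure ℝ) (Set.Ioi 0) = 1
  trans : S → Set C → A → Set C → S → Prop
  initClocks : Set C
  s₀ : S
  reactive : ∀ s K a K' s', trans s K a K' s' → a ∈ input ∪ urgent → K = ∅
  generative : ∀ s K a K' s', trans s K a K' s' → a ∈ inputᶜ \ urgent → ∃ x, K = {x}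
  clock_controls_one : ∀ s x a₁ K₁ s₁ a₂ K₂ s₂,
    trans s {x} a₁ K₁ s₁ → trans s {x} a₂ K₂ s₂ → a₁ = a₂ ∧ K₁ = K₂ ∧ s₁ = s₂
  input_enabled : ∀ a ∈ input, ∀ s, ∃ K' s', trans s ∅ a K' s'
  input_deterministic : ∀ a ∈ input, ∀ s K₁ s₁ K₂ s₂,
    trans s ∅ a K₁ s₁ → trans s ∅ a K₂ s₂ → K₁ = K₂ ∧ s₁ = s₂
  exists_active : ∃ active : S → Set C,
    active s₀ ⊆ initClocks ∧
    (∀ s, enablingClocks trans s ⊆ active s) ∧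
    (∀ s, IsStableState trans (urgent ∩ inputᶜ) s → active s = enablingClocks trans s) ∧
    (∀ t K a K' s, trans t K a K' s → active s ⊆ (active t \ K) ∪ K')

/-- The states of an automaton together with the additional location `init`. -/
inductive Loc (S : Type*)
  | init : Loc S
  | at (s : S) : Loc S

/-- The discrete labels: the labels of the automaton and the additional label `init`. -/
inductive DiscreteLabel (A : Type*)
  | init : DiscreteLabel A
  | act (a : A) : DiscreteLabel A

instance {S : Type*} : MeasurableSpace (Loc S) := ⊤
instance {S : Type*} : DiscreteMeasurableSpace (Loc S) := ⟨fun _ => trivial⟩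
instance {A : Type*} : MeasurableSpace (DiscreteLabel A) := ⊤
instance {A : Type*} : DiscreteMeasurableSpace (DiscreteLabel A) := ⟨fun _ => trivial⟩

/-- The labels of the semantics: discrete labels and delays `d > 0`. -/
abbrev SemLabel (A : Type*) := DiscreteLabel A ⊕ Set.Ioi (0 : ℝ)

/-- The states of the semantics: locations with clock valuations. For countable `S`, the product
σ-algebra is the Borel σ-algebra. -/
abbrev SemState (S C : Type*) := Loc S × (C → ℝ)

/-- The product measure of the point mass at `q` and the measures `m x` of the clock values. -/
def locProd {S C : Type*} [Fintype C] (q : Loc S) (m : C → ProbabilityMeasure ℝ) :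
    ProbabilityMeasure (SemState S C) :=
  ⟨(Measure.dirac q).prod (Measure.pi fun x => (m x : Measure ℝ)), inferInstance⟩

namespace IOSA

variable {S A C : Type*} (I : IOSA S A C)

/-- The output labels. -/
def output : Set A := I.inputᶜ

/-- There are no input labels. -/
def Closed : Prop := I.input = ∅

/-- No urgent output leaves the state `s`. -/
def Stable (s : S) : Prop := IsStableState I.trans (I.urgent ∩ I.output) s

/-- Stability of locations; no transition of the automaton leaves `init`. -/
def StableLoc : Loc S → Prop
  | .init => True
  | .at s => I.Stable s

/-- Confluence with respect to two labels: two transitions from a common state with these labels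
are the same transition, or they can be completed to a diamond. -/
def ConfluentWrt (a b : A) : Prop :=
  ∀ s K₁ s₁ K₂ s₂, I.trans s ∅ a K₁ s₁ → I.trans s ∅ b K₂ s₂ →
    (a = b ∧ K₁ = K₂ ∧ s₁ = s₂) ∨ ∃ s₃, I.trans s₁ ∅ b K₂ s₃ ∧ I.trans s₂ ∅ a K₁ s₃

/-- Confluence with respect to every pair of urgent labels. -/
def Confluent : Prop := ∀ a ∈ I.urgent, ∀ b ∈ I.urgent, I.ConfluentWrt a b

section Semantics

variable [Fintype C]

open Classical in
/-- The measure `μ^v_{K,s}`: the location is `s`, the clocks in `K` are sampled from their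
distributions and the others keep their values in `v`. -/
def resample (v : C → ℝ) (K : Set C) (s : S) : ProbabilityMeasure (SemState S C) :=
  locProd (.at s) fun x => if x ∈ K then I.clock x else diracProba (v x)

/-- The discrete transitions of the semantics. -/
def discreteT : DiscreteLabel A → SemState S C → Set (ProbabilityMeasure (SemState S C))
  | .init, (.init, _) => {locProd (.at I.s₀) I.clock}
  | .act a, (.at s, v) =>
      {μ | ∃ K K' s', I.trans s K a K' s' ∧ (∀ x ∈ K, v x ≤ 0) ∧ μ = I.resample v K' s'}
  | _, _ => ∅

/-- `d` time units may pass in a location with clock values `v`: no urgent output is possible,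
and `d` is at most the value of each clock that controls an output. -/
def CanDelay (d : ℝ) : SemState S C → Prop
  | (.init, _) => True
  | (.at s, v) =>
      (¬ ∃ b ∈ I.output ∩ I.urgent, ∃ K K' s', I.trans s K b K' s') ∧
      ∀ x, (∃ a ∈ I.output, ∃ K' s', I.trans s {x} a K' s') → d ≤ v x

/-- The time transitions of the semantics. -/
def delayT (d : Set.Ioi (0 : ℝ)) (p : SemState S C) : Set (ProbabilityMeasure (SemState S C)) :=
  {μ | I.CanDelay d p ∧ μ = locProd p.1 fun x => diracProba (p.2 x - d)}

/-- The transition function of the semantics of the automaton. -/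
def semT : SemLabel A → SemState S C → Set (ProbabilityMeasure (SemState S C)) :=
  Sum.elim I.discreteT I.delayT

/-! ### Weak transitions -/

/-- A transition with an urgent label, that is, a transition with label `τ` once all the urgent
labels are renamed to `τ`. -/
def UrgentTrans (s : S) (K : Set C) (s' : S) : Prop := ∃ a ∈ I.urgent, I.trans s ∅ a K s'

open Classical in
/-- The function that sends a state to the measure that `R` relates to it, and to the zero
measure if there is none. -/
def measureOf (R : SemState S C → Measure (SemState S C) → Prop) (p : SemState S C) :
    Measure (SemState S C) :=
  if h : ∃ ν, R p ν then h.choose else 0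

/-- `WeakStep n K p μ`: from `p`, the measure `μ` on stable states is reached by `n` urgent
transitions that together reset the clocks in `K`. The last step is a single urgent transition to
a stable state. If an urgent transition leads to a state `s'` from which, for all clock values,
there is a weak transition with `n` steps that resets `K''`, then the measures reached by the
latter are averaged; `Measure.bind m f` is the measure `B ↦ ∫ f(q)(B) dm(q)`. -/
def WeakStep : ℕ → Set C → SemState S C → Measure (SemState S C) → Prop
  | 0, _, _, _ => False
  | n + 1, K, p, μ =>
      (n = 0 ∧ ∃ s s', p.1 = .at s ∧ I.UrgentTrans s K s' ∧ I.Stable s' ∧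
        μ = I.resample p.2 K s') ∨
      (∃ s K' s' K'', p.1 = .at s ∧ I.UrgentTrans s K' s' ∧
        (∀ v', ∃ μ', WeakStep n K'' (.at s', v') μ') ∧ K = K' ∪ K'' ∧
        μ = (I.resample p.2 K' s' : Measure (SemState S C)).bind (measureOf (WeakStep n K'')))

/-- The weak transition relation. -/
def WeakTrans (p : SemState S C) (μ : Measure (SemState S C)) : Prop :=
  ∃ n ≥ 1, ∃ K, I.WeakStep n K p μ

/-- The weak transitions are well defined: the functions that are integrated in their definition
are single-valued and measurable. -/
def WeakTransWellDefined : Prop :=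
  ∀ n ≥ 1, ∀ K : Set C,
    (∀ p μ μ', I.WeakStep n K p μ → I.WeakStep n K p μ' → μ = μ') ∧
    Measurable (measureOf (I.WeakStep n K))

/-! ### Weak determinism -/

/-- Two different discrete transitions are enabled in a stable state. -/
def TwoDiscrete (p : SemState S C) : Prop :=
  I.StableLoc p.1 ∧ ∃ a b, ∃ μ ∈ I.discreteT a p, ∃ μ' ∈ I.discreteT b p, μ ≠ μ'

/-- Weak transitions from an unstable state lead to different measures. -/
def TwoWeak (p : SemState S C) : Prop :=
  ¬ I.StableLoc p.1 ∧ ∃ μ μ', I.WeakTrans p μ ∧ I.WeakTrans p μ' ∧ μ ≠ μ'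

/-- A non-urgent output is enabled in an unstable state. -/
def NonUrgentUnstable (p : SemState S C) : Prop :=
  ¬ I.StableLoc p.1 ∧ ∃ a ∈ I.output \ I.urgent, ∃ μ, μ ∈ I.discreteT (.act a) p

/-- Weak determinism (of a closed automaton). -/
structure WeaklyDeterministic : Prop where
  wellDefined : I.WeakTransWellDefined
  almostNever : ∀ (v₀ : C → ℝ) (B : Set (SemState S C)), MeasurableSet B →
    (∀ p ∈ B, I.TwoDiscrete p ∨ I.TwoWeak p ∨ I.NonUrgentUnstable p) →
    AlmostNeverReached I.semT (.init, v₀) B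

end Semantics

end IOSA

end

/-! ### Almost sure invariants of paths -/

section Invariants

variable {L X : Type*} [MeasurableSpace L] [MeasurableSpace X]

/-! The argument has a combinatorial and a probabilistic half.

In a closed automaton a state is stable iff no urgent transition leaves it. Confluent diamonds close
in one step and preserve both labels and both reset sets, so any urgent transition can be moved to
the front of a run to a stable state. Hence such runs from a given state agree in length, total
reset set and end state (`UrgentRun.unique`). Clocks are independent, so successive resamplings
merge into one resampling of the union (`resample_bind`). Weak transitions are therefore exactly
these runs (`weakStep_succ_eq_runStep`); they are well defined, and condition (ii) holds nowhere.

For (i) and (iii) there is an invariant: active clocks have distinct nonnegative values, positive in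
unstable states. Fresh values are almost surely positive and differ from all others. A stable state
is left by a clock with value 0, so the other active clocks are positive. Delays require stability,
where the enabling clocks, being all the active ones, bound the delay. Thus the invariant is almost
surely preserved (`IsActive.ae_mem_regularStates`), hence never left under any scheduler
(`almostNeverReached_compl_of_invariant`). It excludes (i), which needs two clocks at 0, and (iii),
which needs an expired clock in an unstable state. -/

theorem PathEntry.measurable_state : Measurable (PathEntry.state : PathEntry L X → X) :=
  measurable_fun_sum measurable_id measurable_snd

theorem execKernel_apply (p : L × ProbabilityMeasure X) :
    execKernel L X p = (Measure.dirac p.1).prod (p.2 : Measure X) := by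
  rw [execKernel, Kernel.prod_apply, Kernel.deterministic_apply, Kernel.comap_apply]
  rfl

variable {T : L → X → Set (ProbabilityMeasure X)}

/-- If all transitions from states in `G` almost surely lead to `G`, then so does every step of a
scheduler. -/
theorem Scheduler.ae_step_mem (η : Scheduler T) {G : Set X} (hG : MeasurableSet G)
    (hT : ∀ p ∈ G, ∀ ℓ, ∀ μ ∈ T ℓ p, ∀ᵐ q ∂(μ : Measure X), q ∈ G)
    {n : ℕ} (h : History L X n) (hh : h.last ∈ G) :
    ∀ᵐ e ∂η.step n h, PathEntry.state e ∈ G := by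
  rw [Scheduler.step, Kernel.map_apply _ measurable_inr,
    ae_map_iff measurable_inr.aemeasurable (PathEntry.measurable_state hG)]
  refine Kernel.ae_comp_of_ae_ae (measurable_snd hG) ?_
  filter_upwards [η.admissible n h] with p hp
  rw [execKernel_apply, Measure.dirac_prod]
  exact (ae_map_iff measurable_prodMk_left.aemeasurable (measurable_snd hG)).2 (hT _ hh _ _ hp)

/-- A set that is closed under transitions up to null sets is almost surely never left. -/
theorem almostNeverReached_compl_of_invariant {G : Set X} (hG : MeasurableSet G)
    (hT : ∀ p ∈ G, ∀ ℓ, ∀ μ ∈ T ℓ p, ∀ᵐ q ∂(μ : Measure X), q ∈ G) {x₀ : X} (hx₀ : x₀ ∈ G)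
    {B : Set X} (hB : Disjoint B G) : AlmostNeverReached T x₀ B := by
  intro η
  suffices H : ∀ n, ∀ᵐ ω ∂η.pathMeasure x₀, PathEntry.state (ω n) ∈ G by
    refine measure_mono_null ?_ (ae_iff.1 (ae_all_iff.2 H))
    rintro ω ⟨n, hn⟩ hω
    exact Set.disjoint_left.1 hB hn (hω n)
  have hlast : ∀ n, MeasurableSet {h : History L X n | h.last ∈ G} := fun n =>
    (PathEntry.measurable_state.comp (measurable_pi_apply _)) hG
  have key : ∀ n, ∀ᵐ h ∂(Kernel.partialTraj (X := fun _ => PathEntry L X) η.step 0 n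
      (fun _ => Sum.inl x₀)), History.last h ∈ G := by
    intro n
    induction n with
    | zero =>
      rw [Kernel.partialTraj_self, Kernel.id_apply, ae_dirac_iff (hlast 0)]
      exact hx₀
    | succ n ih =>
      rw [Kernel.partialTraj_succ_eq_comp (Nat.zero_le n)]
      refine Kernel.ae_comp_of_ae_ae (hlast (n + 1)) ?_
      filter_upwards [ih] with h hh
      have hs := η.ae_step_mem hG hT h hh
      -- The one-step kernel is the last marginal of the kernel that extends histories from `n` to
      -- `n + 1`.
      rw [← Kernel.map_partialTraj_succ_self (X := fun _ => PathEntry L X) (κ := η.step) n,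
        Kernel.map_apply _ (measurable_pi_apply _)] at hs
      exact ae_of_ae_map (measurable_pi_apply _).aemeasurable hs
  intro n
  have hn := key n
  rw [← Kernel.traj_map_frestrictLe_apply] at hn
  exact ae_of_ae_map (Preorder.measurable_frestrictLe n).aemeasurable hn

end Invariants

/-! ### Product measures -/

section Product

variable {C : Type*} [Fintype C]

open Classical in
/-- Overwriting the coordinates in `K` by those of an independent copy preserves a product
measure. -/
theorem measurePreserving_overwrite (m : C → ProbabilityMeasure ℝ) (K : Set C) :
    MeasurePreserving (fun (p : (C → ℝ) × (C → ℝ)) x => if x ∈ K then p.2 x else p.1 x)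
      ((Measure.pi fun x => (m x : Measure ℝ)).prod (Measure.pi fun x => (m x : Measure ℝ)))
      (Measure.pi fun x => (m x : Measure ℝ)) := by
  have hmeas : Measurable
      (fun (p : (C → ℝ) × (C → ℝ)) x => if x ∈ K then p.2 x else p.1 x) := by
    refine measurable_pi_lambda _ fun x => ?_
    split_ifs <;> fun_prop
  refine ⟨hmeas, (Measure.pi_eq fun t ht => ?_).symm⟩
  rw [Measure.map_apply hmeas (.univ_pi ht)]
  -- The preimage of a box is a product of two boxes with complementary constraints, so each factor
  -- of the product measure occurs once.
  have : (fun (p : (C → ℝ) × (C → ℝ)) x => if x ∈ K then p.2 x else p.1 x) ⁻¹' Set.univ.pi t =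
      (Set.univ.pi fun x => if x ∈ K then Set.univ else t x) ×ˢ
        (Set.univ.pi fun x => if x ∈ K then t x else Set.univ) := by
    ext p
    simp only [Set.mem_preimage, Set.mem_pi, Set.mem_univ, true_imp_iff, Set.mem_prod,
      ← forall_and]
    refine forall_congr' fun x => ?_
    split_ifs <;> simp
  rw [this, Measure.prod_prod, Measure.pi_pi, Measure.pi_pi, ← Finset.prod_mul_distrib]
  refine Finset.prod_congr rfl fun x _ => ?_
  split_ifs <;> simp

/-- Resampling coordinate `x` independently makes the other value constant by Fubini. Only `x` has
to be atomless: `y` may be a clock that is not reset, with a point mass. -/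
theorem ae_pi_apply_ne (m : C → ProbabilityMeasure ℝ) {x y : C} (hxy : x ≠ y)
    (hx : ∀ r, (m x : Measure ℝ) {r} = 0) :
    ∀ᵐ u ∂Measure.pi fun x => (m x : Measure ℝ), u x ≠ u y := by
  classical
  have hms : MeasurableSet {u : C → ℝ | u x ≠ u y} :=
    (measurableSet_eq_fun (measurable_pi_apply x) (measurable_pi_apply y)).compl
  rw [← (measurePreserving_overwrite m {x}).map_eq,
    ae_map_iff (measurePreserving_overwrite m {x}).aemeasurable hms]
  have hms' : MeasurableSet {p : (C → ℝ) × (C → ℝ) | p.2 x ≠ p.1 y} :=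
    (measurableSet_eq_fun (by fun_prop) (by fun_prop)).compl
  have : ∀ᵐ p ∂((Measure.pi fun x => (m x : Measure ℝ)).prod
      (Measure.pi fun x => (m x : Measure ℝ))), p.2 x ≠ p.1 y := by
    rw [Measure.ae_prod_iff_ae_ae hms']
    refine Filter.Eventually.of_forall fun u => ?_
    have : NullSingletonClass (m x : Measure ℝ) := ⟨hx⟩
    exact Measure.ae_eval_ne (μ := fun x => (m x : Measure ℝ)) x (u y)
  filter_upwards [this] with p hp
  simpa [hxy.symm] using hp

/-- No measurability of `P` is needed, since `u ↦ (q, u)` is a measurable embedding. -/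
theorem ae_locProd_iff {S : Type*} (q : Loc S) (m : C → ProbabilityMeasure ℝ)
    (P : SemState S C → Prop) :
    (∀ᵐ p ∂(locProd q m : Measure (SemState S C)), P p) ↔
      ∀ᵐ u ∂Measure.pi fun x => (m x : Measure ℝ), P (q, u) := by
  change (∀ᵐ p ∂(Measure.dirac q).prod (Measure.pi fun x => (m x : Measure ℝ)), P p) ↔ _
  rw [Measure.dirac_prod]
  exact (MeasurableEmbedding.prodMk_left q MeasurableEmbedding.id).ae_map_iff

end Product

/-! ### Countability of locations, and values of `measureOf` -/

namespace IOSA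

variable {S A C : Type*} (I : IOSA S A C)

instance [Countable S] : Countable (Loc S) := by
  have : Function.Injective fun q : Loc S => match q with
      | .init => none
      | .at s => some s := by
    rintro (_ | s) (_ | t) h <;> simp_all
  exact this.countable

theorem measureOf_eq {R : SemState S C → Measure (SemState S C) → Prop} {p : SemState S C}
    {μ : Measure (SemState S C)} (h : R p μ) (huniq : ∀ ν, R p ν → ν = μ) :
    measureOf R p = μ := by
  have hex : ∃ ν, R p ν := ⟨μ, h⟩
  rw [measureOf, dif_pos hex]
  exact huniq _ hex.choose_spec

theorem measureOf_eq_zero {R : SemState S C → Measure (SemState S C) → Prop} {p : SemState S C}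
    (h : ∀ ν, ¬ R p ν) : measureOf R p = 0 := by
  rw [measureOf, dif_neg (not_exists.2 h)]

/-! ### Urgent runs -/

/-- `I.UrgentRun n K s t`: from `s`, the stable state `t` is reached by `n` urgent transitions
that together reset the clocks in `K`. -/
inductive UrgentRun : ℕ → Set C → S → S → Prop
  | stable {s : S} : I.Stable s → UrgentRun 0 ∅ s s
  | step {n : ℕ} {K K' : Set C} {s s' t : S} :
      I.UrgentTrans s K s' → UrgentRun n K' s' t → UrgentRun (n + 1) (K ∪ K') s t

variable {I}

theorem Closed.stable_iff (hI : I.Closed) {s : S} :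
    I.Stable s ↔ ∀ K s', ¬ I.UrgentTrans s K s' := by
  have : I.input = ∅ := hI
  simp only [Stable, IsStableState, output, UrgentTrans, this]
  constructor
  · rintro h K s' ⟨a, ha, ht⟩
    exact h ⟨a, ⟨ha, by simp⟩, K, s', ht⟩
  · rintro h ⟨a, ha, K, s', ht⟩
    exact h K s' ⟨a, ha.1, ht⟩

theorem Closed.mem_output (hI : I.Closed) (a : A) : a ∈ I.output := by
  have : I.input = ∅ := hI
  simp [output, this]

/-- In a closed automaton, a transition with a non-urgent label is controlled by one clock. -/
theorem Closed.exists_clock (hI : I.Closed) {s s' : S} {K K' : Set C} {a : A}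
    (h : I.trans s K a K' s') (ha : a ∉ I.urgent) : ∃ x, K = {x} :=
  I.generative _ _ _ _ _ h ⟨hI.mem_output a, ha⟩

theorem Closed.not_urgent_of_stable (hI : I.Closed) {s s' : S} {K K' : Set C} {a : A}
    (hs : I.Stable s) (h : I.trans s K a K' s') : a ∉ I.urgent := fun ha => by
  obtain rfl := I.reactive _ _ _ _ _ h (.inr ha)
  exact hI.stable_iff.1 hs _ _ ⟨a, ha, h⟩

/-- Every urgent transition is the first step of some reordering of an urgent run. -/
theorem UrgentRun.exists_tail (hI : I.Closed) (hc : I.Confluent) {n : ℕ} {K : Set C} {s t : S}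
    (h : I.UrgentRun n K s t) :
    ∀ {K₂ : Set C} {s₂ : S}, I.UrgentTrans s K₂ s₂ →
      ∃ m K', n = m + 1 ∧ K = K₂ ∪ K' ∧ I.UrgentRun m K' s₂ t := by
  induction h with
  | stable hs => exact fun h₂ => absurd h₂ (hI.stable_iff.1 hs _ _)
  | @step n K₁ K'' s s₁ t h₁ hr ih =>
    rintro K₂ s₂ ⟨b, hb, h₂⟩
    obtain ⟨a, ha, h₁⟩ := h₁
    obtain ⟨-, rfl, rfl⟩ | ⟨s₃, h₁₃, h₂₃⟩ := hc a ha b hb _ _ _ _ _ h₁ h₂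
    · exact ⟨n, K'', rfl, rfl, hr⟩
    -- The residual of the new transition starts at `s₁`, where the induction hypothesis applies;
    -- the residual of the old first step then leads from `s₂` to `s₃`.
    · obtain ⟨m, K', rfl, rfl, hr'⟩ := ih ⟨b, hb, h₁₃⟩
      exact ⟨m + 1, K₁ ∪ K', rfl, Set.union_left_comm _ _ _, .step ⟨a, ha, h₂₃⟩ hr'⟩

/-- In a closed confluent automaton, urgent runs from a state agree in their length, in the clocks
that they reset, and in the state that they reach. -/
theorem UrgentRun.unique (hI : I.Closed) (hc : I.Confluent) {n : ℕ} {K : Set C} {s t : S}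
    (h : I.UrgentRun n K s t) :
    ∀ {n' : ℕ} {K' : Set C} {t' : S}, I.UrgentRun n' K' s t' → n' = n ∧ K' = K ∧ t' = t := by
  induction h with
  | stable hs =>
    rintro _ _ _ (_ | ⟨h, _⟩)
    · exact ⟨rfl, rfl, rfl⟩
    · exact absurd h (hI.stable_iff.1 hs _ _)
  | step h₁ _ ih =>
    intro n' K' t' h'
    obtain ⟨m, K'', rfl, rfl, hr⟩ := h'.exists_tail hI hc h₁
    obtain ⟨rfl, rfl, rfl⟩ := ih hr
    exact ⟨rfl, rfl, rfl⟩

/-! ### Resampling -/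

open Classical in
theorem measurable_overwrite (K : Set C) (s : S) :
    Measurable fun p : (C → ℝ) × (C → ℝ) =>
      (Loc.at s, fun x => if x ∈ K then p.2 x else p.1 x) := by
  refine measurable_const.prodMk (measurable_pi_lambda _ fun x => ?_)
  split_ifs <;> fun_prop

variable (I) [Fintype C]

open Classical in
-- As a pushforward of one measure that does not depend on `v`, resampling is seen to be measurable
-- in `v` and can be iterated by Fubini.
theorem coe_resample (v : C → ℝ) (K : Set C) (s : S) :
    (I.resample v K s : Measure (SemState S C)) =
      (Measure.pi fun x => (I.clock x : Measure ℝ)).map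
        fun w => (Loc.at s, fun x => if x ∈ K then w x else v x) := by
  have hf : ∀ x, Measurable fun r : ℝ => if x ∈ K then r else v x := fun x => by
    split_ifs <;> fun_prop
  have hpi : (Measure.pi fun x => (I.clock x : Measure ℝ)).map
      (fun w x => if x ∈ K then w x else v x) = Measure.pi fun x =>
        ((if x ∈ K then I.clock x else diracProba (v x) : ProbabilityMeasure ℝ) :
          Measure ℝ) := by
    have : ∀ x, IsProbabilityMeasure
        ((I.clock x : Measure ℝ).map fun r => if x ∈ K then r else v x) := fun x =>
      Measure.isProbabilityMeasure_map (hf x).aemeasurable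
    rw [Measure.pi_map_pi (f := fun x r => if x ∈ K then r else v x)
      fun x => (hf x).aemeasurable]
    congr 1
    ext1 x
    split_ifs
    · exact Measure.map_id
    · rw [Measure.map_const, measure_univ, one_smul]
      rfl
  change (Measure.dirac (Loc.at s)).prod _ = _
  rw [Measure.dirac_prod, ← hpi]
  exact Measure.map_map measurable_prodMk_left
    (measurable_pi_lambda _ fun x => (hf x).comp (measurable_pi_apply x))

open Classical in
theorem resample_apply (v : C → ℝ) (K : Set C) (s : S) {B : Set (SemState S C)}
    (hB : MeasurableSet B) :
    (I.resample v K s : Measure (SemState S C)) B =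
      (Measure.pi fun x => (I.clock x : Measure ℝ)) (Prod.mk v ⁻¹'
        ((fun p : (C → ℝ) × (C → ℝ) => (Loc.at s, fun x => if x ∈ K then p.2 x else p.1 x)) ⁻¹'
          B)) := by
  rw [coe_resample, Measure.map_apply _ hB]
  · rfl
  · exact (measurable_overwrite K s).comp measurable_prodMk_left

theorem measurable_resample (K : Set C) (s : S) :
    Measurable fun v => (I.resample v K s : Measure (SemState S C)) := by
  refine Measure.measurable_of_measurable_coe _ fun B hB => ?_
  simp only [I.resample_apply _ K s hB]
  exact measurable_measure_prodMk_left (measurable_overwrite K s hB)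

/-- Resampling twice amounts to resampling the union of the two sets of clocks. -/
theorem resample_bind {v : C → ℝ} {K K' : Set C} {s t : S}
    {f : SemState S C → Measure (SemState S C)} (hf : Measurable f)
    (hft : ∀ u, f (.at s, u) = I.resample u K' t) :
    (I.resample v K s : Measure (SemState S C)).bind f = I.resample v (K ∪ K') t := by
  classical
  obtain ⟨U, hU⟩ : ∃ U, U = K ∪ K' := ⟨_, rfl⟩
  rw [← hU]
  ext B hB
  have hK : Measurable fun w : C → ℝ =>
      ((Loc.at s, fun x => if x ∈ K then w x else v x) : SemState S C) :=
    (measurable_overwrite K s).comp measurable_prodMk_left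
  have hKu : Measurable fun w : C → ℝ =>
      ((Loc.at t, fun x => if x ∈ U then w x else v x) : SemState S C) :=
    (measurable_overwrite U t).comp (measurable_prodMk_left (x := v))
  -- On the right, the single sample is replaced by two independent ones, the second overwriting the
  -- clocks in `K'`. Both sides become integrals over the first sample.
  rw [Measure.bind_apply hB hf.aemeasurable, coe_resample,
    lintegral_map (f := fun p => f p B) ((Measure.measurable_coe hB).comp hf) hK, coe_resample,
    Measure.map_apply hKu hB, ← (measurePreserving_overwrite I.clock K').measure_preimage
      (hKu hB).nullMeasurableSet,
    Measure.prod_apply ((measurePreserving_overwrite I.clock K').measurable (hKu hB))]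
  refine lintegral_congr fun w => ?_
  rw [hft, I.resample_apply _ _ _ hB]
  congr 1
  ext w'
  simp only [Set.mem_preimage]
  have : (fun x => if x ∈ K' then w' x else if x ∈ K then w x else v x) =
      fun x => if x ∈ U then (if x ∈ K' then w' x else w x) else v x := by
    ext x
    by_cases h : x ∈ K <;> by_cases h' : x ∈ K' <;> simp [hU, h, h']
  rw [this]

/-- Resampled clocks are positive and differ from all the other clocks. -/
theorem ae_resample (v : C → ℝ) (K : Set C) (s : S) :
    ∀ᵐ p ∂(I.resample v K s : Measure (SemState S C)), p.1 = .at s ∧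
      (∀ x ∉ K, p.2 x = v x) ∧ (∀ x ∈ K, 0 < p.2 x) ∧ ∀ x ∈ K, ∀ y ≠ x, p.2 x ≠ p.2 y := by
  classical
  rw [resample, ae_locProd_iff]
  simp only [Filter.eventually_and, ae_all_iff]
  refine ⟨Filter.Eventually.of_forall fun _ => trivial, fun x hx => ?_, fun x hx => ?_,
    fun x hx y hy => ae_pi_apply_ne _ hy.symm ?_⟩
  · refine Measure.tendsto_eval_ae_ae.eventually (p := fun r => r = v x) ?_
    rw [if_neg hx]
    exact (ae_dirac_iff (measurableSet_singleton _)).2 rfl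
  · refine Measure.tendsto_eval_ae_ae.eventually (p := fun r => 0 < r) ?_
    rw [if_pos hx]
    exact (prob_compl_eq_zero_iff measurableSet_Ioi).2 (I.clock_pos x)
  · simpa only [if_pos hx] using I.clock_continuous x

/-! ### Weak transitions -/

/-- The relation that the urgent runs with `n` steps that reset `K` induce on the semantics. -/
def RunStep (n : ℕ) (K : Set C) (p : SemState S C) (μ : Measure (SemState S C)) : Prop :=
  ∃ s t, p.1 = .at s ∧ I.UrgentRun n K s t ∧ μ = I.resample p.2 K t

variable {I}

theorem RunStep.unique (hI : I.Closed) (hc : I.Confluent) {n n' : ℕ} {K K' : Set C}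
    {p : SemState S C} {μ μ' : Measure (SemState S C)} (h : I.RunStep n K p μ)
    (h' : I.RunStep n' K' p μ') : μ = μ' := by
  obtain ⟨s, t, hs, hr, rfl⟩ := h
  obtain ⟨s', t', hs', hr', rfl⟩ := h'
  obtain rfl : s = s' := Loc.at.inj (hs.symm.trans hs')
  obtain ⟨-, rfl, rfl⟩ := hr.unique hI hc hr'
  rfl

theorem measureOf_runStep (hI : I.Closed) (hc : I.Confluent) {n : ℕ} {K : Set C} {s t : S}
    (h : I.UrgentRun n K s t) (v : C → ℝ) :
    measureOf (I.RunStep n K) (.at s, v) = I.resample v K t :=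
  have hR : I.RunStep n K (.at s, v) (I.resample v K t) := ⟨s, t, rfl, h, rfl⟩
  measureOf_eq hR fun _ hν => hν.unique hI hc hR

/-- With countably many locations, it suffices to fix one; the function of the valuation is then a
resampling or zero. -/
theorem measurable_measureOf_runStep [Countable S] (hI : I.Closed) (hc : I.Confluent) (n : ℕ)
    (K : Set C) : Measurable (measureOf (I.RunStep n K)) := by
  refine measurable_from_prod_countable_right fun q => ?_
  by_cases h : ∃ s t, q = .at s ∧ I.UrgentRun n K s t
  · obtain ⟨s, t, rfl, hr⟩ := h
    simp only [measureOf_runStep hI hc hr]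
    exact I.measurable_resample K t
  · have : ∀ v, measureOf (I.RunStep n K) (q, v) = 0 := fun v =>
      measureOf_eq_zero fun ν ⟨s, t, hs, hr, _⟩ => h ⟨s, t, hs, hr⟩
    simp only [this]
    exact measurable_const

/-- Whether a run exists does not depend on the clock values, so the quantifier over all valuations
in (T2) costs nothing. The index starts at 1 because `UrgentRun` also has the empty run, while
`WeakStep 0` is empty. -/
theorem weakStep_succ_eq_runStep [Countable S] (hI : I.Closed) (hc : I.Confluent) (n : ℕ) :
    I.WeakStep (n + 1) = I.RunStep (n + 1) := by
  induction n with
  | zero =>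
    ext K p μ
    rw [WeakStep]
    constructor
    · rintro (⟨-, s, s', hp, ht, hs', rfl⟩ | ⟨s, K', s', K'', -, -, h, -⟩)
      · refine ⟨s, s', hp, ?_, rfl⟩
        simpa using UrgentRun.step ht (.stable hs')
      · exact (h 0).choose_spec.elim
    · rintro ⟨s, t, hp, hr, rfl⟩
      obtain _ | ⟨ht, hr⟩ := hr
      obtain ⟨hs⟩ := hr
      exact .inl ⟨rfl, s, t, hp, by simpa using ht, hs, rfl⟩
  | succ n ih =>
    have hbind : ∀ {v : C → ℝ} {K K' : Set C} {s' t : S}, I.UrgentRun (n + 1) K' s' t →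
        (I.resample v K s' : Measure (SemState S C)).bind (measureOf (I.RunStep (n + 1) K')) =
          I.resample v (K ∪ K') t := fun hr =>
      I.resample_bind (measurable_measureOf_runStep hI hc _ _) (measureOf_runStep hI hc hr)
    ext K p μ
    rw [WeakStep, ih]
    constructor
    · rintro (⟨h, -⟩ | ⟨s, K', s', K'', hp, ht, h, rfl, rfl⟩)
      · omega
      · obtain ⟨_, _, t, hs, hr, -⟩ := h 0
        obtain rfl := Loc.at.inj hs
        exact ⟨s, t, hp, .step ht hr, hbind hr⟩
    · rintro ⟨s, t, hp, hr, rfl⟩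
      obtain _ | ⟨ht, hr⟩ := hr
      exact .inr ⟨s, _, _, _, hp, ht, fun v' => ⟨_, _, t, rfl, hr, rfl⟩, rfl,
        (hbind hr).symm⟩

theorem weakTransWellDefined [Countable S] (hI : I.Closed) (hc : I.Confluent) :
    I.WeakTransWellDefined := by
  intro n hn K
  obtain ⟨n, rfl⟩ := Nat.exists_eq_succ_of_ne_zero (Nat.one_le_iff_ne_zero.1 hn)
  rw [Nat.succ_eq_add_one, weakStep_succ_eq_runStep hI hc]
  exact ⟨fun p μ μ' h h' => h.unique hI hc h', measurable_measureOf_runStep hI hc _ _⟩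

theorem WeakTrans.unique [Countable S] (hI : I.Closed) (hc : I.Confluent) {p : SemState S C}
    {μ μ' : Measure (SemState S C)} (h : I.WeakTrans p μ) (h' : I.WeakTrans p μ') : μ = μ' := by
  obtain ⟨n, hn, K, h⟩ := h
  obtain ⟨n', hn', K', h'⟩ := h'
  obtain ⟨n, rfl⟩ := Nat.exists_eq_succ_of_ne_zero (Nat.one_le_iff_ne_zero.1 hn)
  obtain ⟨n', rfl⟩ := Nat.exists_eq_succ_of_ne_zero (Nat.one_le_iff_ne_zero.1 hn')
  rw [Nat.succ_eq_add_one, weakStep_succ_eq_runStep hI hc] at h h'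
  exact h.unique hI hc h'

/-! ### The regular states -/

variable (I)

/-- `active` satisfies the conditions on the active clocks of `I`. -/
structure IsActive (active : S → Set C) : Prop where
  enabling_subset : ∀ s, enablingClocks I.trans s ⊆ active s
  eq_enabling : ∀ s, I.Stable s → active s = enablingClocks I.trans s
  trans_subset : ∀ t K a K' s, I.trans t K a K' s → active s ⊆ (active t \ K) ∪ K'

/-- The states in which the active clocks have different, nonnegative values, which are positive
if the state is unstable. All states with location `init` are included. -/
def regularStates (active : S → Set C) : Set (SemState S C) :=
  {p | ∀ s, p.1 = .at s →
    (∀ x ∈ active s, 0 ≤ p.2 x) ∧ (∀ x ∈ active s, ∀ y ∈ active s, x ≠ y → p.2 x ≠ p.2 y) ∧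
      (¬ I.Stable s → ∀ x ∈ active s, 0 < p.2 x)}

theorem measurableSet_regularStates [Countable S] (active : S → Set C) :
    MeasurableSet (I.regularStates active) := by
  have hC : Countable C := Finite.to_countable
  have hx : ∀ x, Measurable fun p : SemState S C => p.2 x := fun x =>
    (measurable_pi_apply x).comp measurable_snd
  have hpos : ∀ x, Measurable fun p : SemState S C => 0 < p.2 x := fun x =>
    measurableSet_setOfPred.1 (measurableSet_lt measurable_const (hx x))
  have hnonneg : ∀ x, Measurable fun p : SemState S C => 0 ≤ p.2 x := fun x =>
    measurableSet_setOfPred.1 (measurableSet_le measurable_const (hx x))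
  have hne : ∀ x y, Measurable fun p : SemState S C => p.2 x ≠ p.2 y := fun x y =>
    (measurableSet_setOfPred.1 (measurableSet_eq_fun (hx x) (hx y))).not
  refine measurableSet_setOfPred.2 (.forall fun s => .imp ?_ (.and ?_ (.and ?_ ?_)))
  · exact measurableSet_setOfPred.1 (measurable_fst (measurableSet_singleton (Loc.at s)))
  · exact .forall fun x => measurable_const.imp (hnonneg x)
  · exact .forall fun x => measurable_const.imp <| .forall fun y =>
      measurable_const.imp <| measurable_const.imp (hne x y)
  · exact measurable_const.imp <| .forall fun x => measurable_const.imp (hpos x)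

variable {I}

/-- A transition from active clocks with different, positive values leads almost surely to a
regular state. -/
theorem ae_resample_mem_regularStates {active : S → Set C} {D : Set C} {v : C → ℝ}
    (hpos : ∀ x ∈ D, 0 < v x) (hne : ∀ x ∈ D, ∀ y ∈ D, x ≠ y → v x ≠ v y) {K : Set C} {s : S}
    (hs : active s ⊆ D ∪ K) :
    ∀ᵐ p ∂(I.resample v K s : Measure (SemState S C)), p ∈ I.regularStates active := by
  filter_upwards [I.ae_resample v K s] with p hp s' hs'
  obtain ⟨hp₁, hkeep, hKpos, hKne⟩ := hp
  obtain rfl : s = s' := Loc.at.inj (hp₁.symm.trans hs')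
  have hall : ∀ x ∈ active s, 0 < p.2 x := by
    intro x hx
    by_cases hxK : x ∈ K
    · exact hKpos x hxK
    · exact hkeep x hxK ▸ hpos x ((hs hx).resolve_right hxK)
  refine ⟨fun x hx => (hall x hx).le, fun x hx y hy hxy => ?_, fun _ => hall⟩
  by_cases hxK : x ∈ K
  · exact hKne x hxK y hxy.symm
  by_cases hyK : y ∈ K
  · exact (hKne y hyK x hxy).symm
  · rw [hkeep x hxK, hkeep y hyK]
    exact hne x ((hs hx).resolve_right hxK) y ((hs hy).resolve_right hyK) hxy

/-- The regular states are closed under the transitions of the semantics, up to null sets. -/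
theorem IsActive.ae_mem_regularStates {active : S → Set C} (hact : I.IsActive active)
    (hI : I.Closed) {p : SemState S C} (hp : p ∈ I.regularStates active) (ℓ : SemLabel A)
    {μ : ProbabilityMeasure (SemState S C)} (hμ : μ ∈ I.semT ℓ p) :
    ∀ᵐ q ∂(μ : Measure (SemState S C)), q ∈ I.regularStates active := by
  obtain ⟨q, v⟩ := p
  obtain (_ | a) | d := ℓ
  · obtain _ | s := q
    · obtain rfl : μ = locProd (.at I.s₀) I.clock := hμ
      have : locProd (.at I.s₀) I.clock = I.resample v Set.univ I.s₀ := by simp [resample]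
      rw [this]
      -- All clocks are sampled, so nothing is required of the old values.
      exact ae_resample_mem_regularStates (D := ∅) (by simp) (by simp) (by simp)
    · exact hμ.elim
  · obtain _ | s := q
    · exact hμ.elim
    obtain ⟨K, K', s', ht, hK, rfl⟩ := hμ
    obtain ⟨hnonneg, hne, hunst⟩ := hp s rfl
    refine ae_resample_mem_regularStates (fun x hx => ?_)
      (fun x hx y hy => hne x hx.1 y hy.1) (hact.trans_subset _ _ _ _ _ ht)
    by_cases hs : I.Stable s
    -- The controlling clock `y` is expired and nonnegative, so it is 0; distinctness makes every
    -- other active clock positive.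
    · obtain ⟨y, rfl⟩ := hI.exists_clock ht (hI.not_urgent_of_stable hs ht)
      have hy : y ∈ active s := hact.enabling_subset s ⟨a, K', s', ht⟩
      have hxy : x ≠ y := hx.2
      have hvy : v y = 0 := le_antisymm (hK y rfl) (hnonneg y hy)
      exact lt_of_le_of_ne (hnonneg x hx.1) (hvy ▸ (hne x hx.1 y hy hxy).symm)
    · exact hunst hs x hx.1
  · obtain ⟨hd, rfl⟩ := hμ
    rw [ae_locProd_iff]
    have hv : ∀ᵐ u ∂Measure.pi fun x => ((diracProba (v x - d) : ProbabilityMeasure ℝ) :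
        Measure ℝ), ∀ x, u x = v x - d := by
      refine ae_all_iff.2 fun x => ?_
      refine Measure.tendsto_eval_ae_ae.eventually (p := fun r => r = v x - d) ?_
      exact (ae_dirac_iff (measurableSet_singleton _)).2 rfl
    filter_upwards [hv] with u hu s hs
    obtain rfl : q = .at s := hs
    obtain ⟨-, hne, -⟩ := hp s rfl
    have hst : I.Stable s := hI.stable_iff.2 fun K s' ⟨a, ha, ht⟩ =>
      hd.1 ⟨a, ⟨hI.mem_output a, ha⟩, ∅, K, s', ht⟩
    refine ⟨fun x hx => ?_, fun x hx y hy hxy => ?_, fun h => absurd hst h⟩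
    -- By stability, every active clock controls an output and therefore bounds `d`.
    · rw [hact.eq_enabling s hst] at hx
      obtain ⟨a, K', s', ht⟩ := hx
      have := hd.2 x ⟨a, hI.mem_output a, K', s', ht⟩
      simp only [hu]
      linarith
    · simp only [hu]
      exact fun h => hne x hx y hy hxy (sub_left_injective h)

/-! ### Conditions (i) and (iii) fail at regular states -/

/-- Since a clock controls at most one transition, two different measures come from two different
clocks. Both are expired, hence both 0, against distinctness. -/
theorem IsActive.not_twoDiscrete {active : S → Set C} (hact : I.IsActive active)
    (hI : I.Closed) {p : SemState S C} (hp : p ∈ I.regularStates active) :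
    ¬ I.TwoDiscrete p := by
  rintro ⟨hst, a, b, μ, hμ, μ', hμ', hne⟩
  obtain ⟨_ | s, v⟩ := p
  · obtain _ | a := a
    · obtain _ | b := b
      · exact hne (Eq.trans (b := locProd (.at I.s₀) I.clock) hμ (Eq.symm hμ'))
      · exact hμ'
    · exact hμ
  obtain _ | a := a
  · exact hμ
  obtain _ | b := b
  · exact hμ'
  obtain ⟨K₁, K₁', s₁, ht₁, hK₁, rfl⟩ := hμ
  obtain ⟨K₂, K₂', s₂, ht₂, hK₂, rfl⟩ := hμ'
  obtain ⟨x, rfl⟩ := hI.exists_clock ht₁ (hI.not_urgent_of_stable hst ht₁)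
  obtain ⟨y, rfl⟩ := hI.exists_clock ht₂ (hI.not_urgent_of_stable hst ht₂)
  have hxy : x ≠ y := by
    rintro rfl
    obtain ⟨-, rfl, rfl⟩ := I.clock_controls_one _ _ _ _ _ _ _ _ ht₁ ht₂
    exact hne rfl
  obtain ⟨hnonneg, hdiff, -⟩ := hp s rfl
  have hx : x ∈ active s := hact.enabling_subset s ⟨a, K₁', s₁, ht₁⟩
  have hy : y ∈ active s := hact.enabling_subset s ⟨b, K₂', s₂, ht₂⟩
  exact hdiff x hx y hy hxy (((hK₁ x rfl).antisymm (hnonneg x hx)).trans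
    ((hK₂ y rfl).antisymm (hnonneg y hy)).symm)

theorem IsActive.not_nonUrgentUnstable {active : S → Set C} (hact : I.IsActive active)
    (hI : I.Closed) {p : SemState S C} (hp : p ∈ I.regularStates active) :
    ¬ I.NonUrgentUnstable p := by
  rintro ⟨hst, a, ha, μ, hμ⟩
  obtain ⟨_ | s, v⟩ := p
  · exact hμ
  obtain ⟨K, K', s', ht, hK, rfl⟩ := hμ
  obtain ⟨x, rfl⟩ := hI.exists_clock ht ha.2
  exact (hK x rfl).not_gt ((hp s rfl).2.2 hst x (hact.enabling_subset s ⟨a, K', s', ht⟩))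

end IOSA

theorem mainTheorem1 {S A C : Type*} [Countable S] [Countable A] [Fintype C]
    (I : IOSA S A C) (hclosed : I.Closed) (hconfluent : I.Confluent) :
    I.WeaklyDeterministic := by
  refine ⟨IOSA.weakTransWellDefined hclosed hconfluent, fun v₀ B _ hB => ?_⟩
  obtain ⟨active, -, henab, hstable, htrans⟩ := I.exists_active
  have hact : I.IsActive active := ⟨henab, hstable, htrans⟩
  refine almostNeverReached_compl_of_invariant (G := I.regularStates active)
    (I.measurableSet_regularStates active)
    -- The starting state is regular vacuously, its location being `init`.
    (fun p hp ℓ μ hμ => hact.ae_mem_regularStates hclosed hp ℓ hμ) (by rintro s ⟨⟩) ?_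
  refine Set.disjoint_left.2 fun p hpB hp => ?_
  obtain h | ⟨-, μ, μ', h, h', hne⟩ | h := hB p hpB
  · exact hact.not_twoDiscrete hclosed hp h
  · exact hne (h.unique hclosed hconfluent h')
  · exact hact.not_nonUrgentUnstable hclosed hp h
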